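/- Let $\Gamma$ be a discrete abelian group (written additively), let $X$ and $Y$ be finite dimensional complex Hilbert spaces, and let $G=(V,E)$ be a simple undirected graph with $V$ finite or countably infinite. Let $\mathcal G=(G,\varphi,\theta,\tau)$ be a $\Gamma$-symmetric framework, that is: * $\varphi=(\varphi_{v,w})_{v,w\in V}$ is a family of linear maps $X\to Y$ with $\varphi_{v,w}=0$ if $vw\notin E$ and $\varphi_{v,w}=-\varphi_{w,v}$ if $vw\in E$; * $\theta:\Gamma\to\operatorname{Aut}(G)$ is a homomorphism acting freely on the vertices and on the edges of $G$ (we write $\gamma v$ for $\theta(\gamma)v$), and the sets $V_0$ of vertex orbits and $E_0$ of edge orbits are finite; * $\tau$ is a homomorphism from $\Gamma$ to the group of affine isometries of $X$ such that, with $d\tau(\gamma)$ the linear part of $\tau(\gamma)$, $\varphi_{\gamma v,\gamma w}=\varphi_{v,w}\circ d\tau(-\gamma)$ for all $\gamma\in\Gamma$ and $v,w\in V$. Fix a gain graph: a representative $\tilde v$ of each vertex orbit $[v]$ and, for each edge orbit $[e]$, an orientation $[e]=([v],[w])$ as an edge of the quotient graph and a gain, i.e. an element $\gamma\in\Gamma$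 such that $\tilde e=\tilde v(\gamma\tilde w)$ is an edge of $G$ in $[e]$ (the gain is unique unless $[v]=[w]$). Let $\hat\Gamma$ be the compact dual group with normalised Haar measure. For a finite dimensional Hilbert space $H$ let $F_H:\ell^2(\Gamma,H)\to L^2(\hat\Gamma,H)$, $(F_Hf)(\chi)=\sum_{\gamma}\overline{\chi(\gamma)}f(\gamma)$ (convergence in $L^2$), be the unitary Fourier transform. Let $S_V:\ell^2(V,X)\to\ell^2(\Gamma,X^{V_0})$, $S_V(z)_\gamma=(z_{\gamma\tilde v})_{[v]\in V_0}$, and $S_E:\ell^2(E,Y)\to\ell^2(\Gamma,Y^{E_0})$, $S_E(z)_\gamma=(z_{\gamma\tilde e})_{[e]\in E_0}$. Let $T_{\tilde\tau}$ be the unitary operator on $\ell^2(\Gamma,X^{V_0})$ with $(T_{\tilde\tau}f)(\gamma)=(d\tau(-\gamma)f(\gamma)_{[v]})_{[v]\in V_0}$, and let $M_\Phi$ denote multiplication by $\Phi$. The coboundary matrix $C(G,\varphi)$ maps $z=(z_v)_{v\in V}$ to $(\varphi_{v,w}(z_v-z_w))_{vw\in E}$. A function $\Phi\in L^\infty(\hat\Gamma,B(X^{V_0},Y^{E_0}))$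 is called a symbol function of $\mathcal G$ if $C(G,\varphi)$ is a bounded operator $\ell^2(V,X)\to\ell^2(E,Y)$ and $$C(G,\varphi)=S_E^{-1}\circ F_{Y^{E_0}}^{-1}\circ M_\Phi\circ F_{X^{V_0}}\circ T_{\tilde\tau}\circ S_V .$$ For $\chi\in\hat\Gamma$, the $\chi$-orbit matrix $O_{\mathcal G}(\chi):X^{V_0}\to Y^{E_0}$ has rows indexed by $E_0$ and columns indexed by $V_0$. The row of a non-loop directed edge $([v],[w])$ with gain $\gamma$ has the entry $\varphi_{\tilde v,\gamma\tilde w}$ in column $[v]$, the entry $\chi(\gamma)\varphi_{\tilde w,-\gamma\tilde v}$ in column $[w]$, and zeros elsewhere. The row of a loop $([v],[v])$ with gain $\gamma$ has the entry $\varphi_{\tilde v,\gamma\tilde v}+\chi(\gamma)\varphi_{\tilde v,-\gamma\tilde v}$ in column $[v]$ and zeros elsewhere. **Theorem 3.7.** The framework $\mathcal G$ has a symbol function, and every symbol function $\Phi$ of $\mathcal G$ satisfies $$\Phi(\chi)=O_{\mathcal G}(\chi)\qquad\text{for almost every }\chi\in\hat\Gamma .$$ -/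

import Mathlib

open MeasureTheory
open scoped ENNReal ComplexConjugate

namespace SymFrame

noncomputable section

/-- The dual group `Γ̂` of a discrete (additive) abelian group `Γ`: all characters `Γ → 𝕋`. -/
abbrev Dual (Γ : Type*) [AddCommGroup Γ] [TopologicalSpace Γ] : Type _ :=
  PontryaginDual (Multiplicative Γ)

/-- The value `χ(γ)` as a complex number. -/
def ev {Γ : Type*} [AddCommGroup Γ] [TopologicalSpace Γ] (χ : Dual Γ) (γ : Γ) : ℂ :=
  ((χ (Multiplicative.ofAdd γ) : Circle) : ℂ)

section DualGroup

variable {Γ : Type*} [AddCommGroup Γ] [TopologicalSpace Γ]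

instance : MeasurableSpace (Dual Γ) := borel _

instance : BorelSpace (Dual Γ) := ⟨rfl⟩

theorem ev_zero (χ : Dual Γ) : ev χ 0 = 1 := by simp [ev]

theorem ev_add (χ : Dual Γ) (a b : Γ) : ev χ (a + b) = ev χ a * ev χ b := by
  simp [ev, ofAdd_add]

theorem ev_neg (χ : Dual Γ) (a : Γ) : ev χ (-a) = conj (ev χ a) := by
  rw [ev, ofAdd_neg, map_inv, Circle.coe_inv_eq_conj, ev]

theorem ev_mul (χ ψ : Dual Γ) (a : Γ) : ev (χ * ψ) a = ev χ a * ev ψ a := by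
  have : (χ * ψ) (Multiplicative.ofAdd a) =
    χ (Multiplicative.ofAdd a) * ψ (Multiplicative.ofAdd a) := rfl
  simp [ev, this]

theorem norm_ev (χ : Dual Γ) (a : Γ) : ‖ev χ a‖ = 1 := Circle.norm_coe _

theorem continuous_ev (a : Γ) : Continuous fun χ : Dual Γ => ev χ a := by
  refine continuous_subtype_val.comp ?_
  exact (continuous_eval_const (F := Multiplicative Γ →ₜ* Circle) (Multiplicative.ofAdd a))

variable [DiscreteTopology Γ]

variable (Γ) in
/-- The normalised Haar measure on the compact group `Γ̂`. -/
def dualHaar : Measure (Dual Γ) := Measure.haarMeasure ⊤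

instance : IsProbabilityMeasure (dualHaar Γ) :=
  ⟨by simpa [dualHaar] using
    Measure.haarMeasure_self (K₀ := (⊤ : TopologicalSpace.PositiveCompacts (Dual Γ)))⟩

instance : (dualHaar Γ).IsMulLeftInvariant := by unfold dualHaar; infer_instance

instance : (dualHaar Γ).Regular := by unfold dualHaar; infer_instance

/-- The characters separate the points of a discrete abelian group. -/
theorem exists_ev_ne_one {a : Γ} (ha : a ≠ 0) : ∃ χ : Dual Γ, ev χ a ≠ 1 := by
  obtain ⟨c, hc⟩ := CharacterModule.exists_character_apply_ne_zero_of_ne_zero ha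
  have h1 : Function.Injective (fun q : AddCircle (1 : ℚ) => q) := fun _ _ h => h
  let m : AddCircle (1 : ℚ) →+ AddCircle (1 : ℝ) :=
    QuotientAddGroup.map _ _ (Rat.castHom ℝ).toAddMonoidHom (by
      intro x hx
      obtain ⟨n, rfl⟩ := AddSubgroup.mem_zmultiples_iff.1 hx
      exact AddSubgroup.mem_zmultiples_iff.2 ⟨n, by simp⟩)
  have hm : ∀ q, m q = 0 → q = 0 := by
    intro q
    induction q using QuotientAddGroup.induction_on with
    | H q =>
      intro h
      have h' : ((q : ℝ) : AddCircle (1 : ℝ)) = 0 := h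
      rw [AddCircle.coe_eq_zero_iff] at h'
      obtain ⟨n, hn⟩ := h'
      refine (AddCircle.coe_eq_zero_iff (1 : ℚ)).2 ⟨n, ?_⟩
      have : ((n : ℚ) : ℝ) = (q : ℝ) := by simpa using hn
      simpa using (Rat.cast_injective this)
  let χ : Multiplicative Γ →ₜ* Circle :=
    { toFun := fun g => (m (c g.toAdd)).toCircle
      map_one' := by simp
      map_mul' := fun x y => by simp [AddCircle.toCircle_add]
      continuous_toFun := continuous_of_discreteTopology }
  refine ⟨χ, fun h => hc (hm _ ?_)⟩
  have h2 : (m (c a)).toCircle = 1 := Circle.ext h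
  rw [← AddCircle.toCircle_zero (T := (1 : ℝ))] at h2
  exact AddCircle.injective_toCircle one_ne_zero h2

theorem integral_ev_eq_zero {a : Γ} (ha : a ≠ 0) : ∫ χ, ev χ a ∂(dualHaar Γ) = 0 := by
  obtain ⟨ψ, hψ⟩ := exists_ev_ne_one ha
  have h := integral_mul_left_eq_self (μ := dualHaar Γ) (fun χ => ev χ a) ψ
  simp only [ev_mul, integral_const_mul] at h
  have h3 : (ev ψ a - 1) * ∫ χ, ev χ a ∂(dualHaar Γ) = 0 := by linear_combination h
  exact (mul_eq_zero.1 h3).resolve_left (sub_ne_zero.2 hψ)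

/-- The conjugate character functions `χ ↦ conj (χ(γ))` span a dense subspace of `C(Γ̂)`. -/
theorem span_char_dense :
    (Submodule.span ℂ (Set.range fun γ : Γ =>
      (⟨fun χ => conj (ev χ γ), (continuous_ev γ).star⟩ : C(Dual Γ, ℂ)))).topologicalClosure
      = ⊤ := by
  set e : Γ → C(Dual Γ, ℂ) :=
    fun γ => ⟨fun χ => conj (ev χ γ), (continuous_ev γ).star⟩ with he
  let A : StarSubalgebra ℂ C(Dual Γ, ℂ) :=
    { toSubalgebra := Algebra.adjoin ℂ (Set.range e)
      star_mem' := by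
        change Algebra.adjoin ℂ (Set.range e) ≤ star (Algebra.adjoin ℂ (Set.range e))
        refine Algebra.adjoin_le ?_
        rintro - ⟨γ, rfl⟩
        refine Algebra.subset_adjoin ⟨-γ, ?_⟩
        ext χ
        simp [he, ev_neg] }
  have hA : Subalgebra.toSubmodule A.toSubalgebra = Submodule.span ℂ (Set.range e) := by
    apply Algebra.adjoin_eq_span_of_subset
    refine Set.Subset.trans ?_ Submodule.subset_span
    intro x hx
    refine Submonoid.closure_induction (fun _ => id) ⟨0, ?_⟩ ?_ hx
    · ext χ; simp [he, ev_zero]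
    · rintro - - - - ⟨a, rfl⟩ ⟨b, rfl⟩
      exact ⟨a + b, by ext χ; simp [he, ev_add]⟩
  have hsep : A.SeparatesPoints := by
    intro x y hxy
    have : ∃ γ : Γ, ev x γ ≠ ev y γ := by
      by_contra! h
      exact hxy (PontryaginDual.ext fun g => Circle.ext (h g.toAdd))
    obtain ⟨γ, hγ⟩ := this
    refine ⟨_, ⟨e γ, Algebra.subset_adjoin ⟨γ, rfl⟩, rfl⟩, ?_⟩
    exact fun h => hγ ((starRingEnd ℂ).injective h)
  rw [← hA]
  exact congr_arg (Subalgebra.toSubmodule <| StarSubalgebra.toSubalgebra ·)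
    (ContinuousMap.starSubalgebra_topologicalClosure_eq_top_of_separatesPoints A hsep)

end DualGroup

section Fourier

/-- `ℓ²(Γ, H)`, and `ℓ²` of any index set with values in `H`. -/
abbrev ell2 (ι H : Type*) [NormedAddCommGroup H] : Type _ := lp (fun _ : ι => H) 2

/-- `L²(Γ̂, H)` for the normalised Haar measure. -/
abbrev L2Dual (Γ : Type*) [AddCommGroup Γ] [TopologicalSpace Γ] [DiscreteTopology Γ]
    (H : Type*) [NormedAddCommGroup H] : Type _ := Lp H 2 (dualHaar Γ)

variable (Γ : Type*) [AddCommGroup Γ] [TopologicalSpace Γ] [DiscreteTopology Γ]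
variable (H : Type*) [NormedAddCommGroup H] [InnerProductSpace ℂ H] [SecondCountableTopology H]

variable {Γ H} in
/-- The continuous function `χ ↦ conj (χ(γ)) x` on `Γ̂`. -/
def charFun (γ : Γ) (x : H) : C(Dual Γ, H) :=
  ⟨fun χ => conj (ev χ γ) • x, (continuous_ev γ).star.smul continuous_const⟩

variable {Γ H} in
theorem coeFn_charFun_toLp (γ : Γ) (x : H) :
    (ContinuousMap.toLp (E := H) 2 (dualHaar Γ) ℂ (charFun γ x) : L2Dual Γ H)
      =ᵐ[dualHaar Γ] fun χ => conj (ev χ γ) • x :=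
  ContinuousMap.coeFn_toLp _ _

variable {Γ H} in
theorem inner_charFun (a b : Γ) (x y : H) :
    inner ℂ (ContinuousMap.toLp (E := H) 2 (dualHaar Γ) ℂ (charFun a x) : L2Dual Γ H)
      (ContinuousMap.toLp (E := H) 2 (dualHaar Γ) ℂ (charFun b y) : L2Dual Γ H)
      = (∫ χ, ev χ (a - b) ∂(dualHaar Γ)) * inner ℂ x y := by
  rw [L2.inner_def, ← integral_mul_const]
  refine integral_congr_ae ?_
  filter_upwards [coeFn_charFun_toLp a x, coeFn_charFun_toLp b y] with χ h1 h2
  rw [h1, h2, inner_smul_left, inner_smul_right, sub_eq_add_neg, ev_add, ev_neg]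
  simp [mul_assoc]

/-- The image under the Fourier transform of the copy of `H` supported at `γ`:
`x ↦ (χ ↦ conj (χ(γ)) x)`. -/
def charIsometry (γ : Γ) : H →ₗᵢ[ℂ] L2Dual Γ H where
  toFun x := ContinuousMap.toLp (E := H) 2 (dualHaar Γ) ℂ (charFun γ x)
  map_add' x y := by
    rw [← map_add]; congr 1; ext χ; simp [charFun]
  map_smul' c x := by
    rw [RingHom.id_apply, ← map_smul]; congr 1; ext χ; simp [charFun, smul_comm c]
  norm_map' x := by
    have h := inner_charFun γ γ x x
    simp only [sub_self, ev_zero, integral_const, probReal_univ, one_smul, one_mul] at h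
    rw [@norm_eq_sqrt_re_inner ℂ, @norm_eq_sqrt_re_inner ℂ _ _ _ _ x]
    exact congrArg (fun z => Real.sqrt (RCLike.re z)) h

theorem charIsometry_orthogonal :
    OrthogonalFamily ℂ (fun _ : Γ => H) (charIsometry Γ H) := by
  intro a b hab x y
  refine (inner_charFun a b x y).trans ?_
  rw [integral_ev_eq_zero (sub_ne_zero.2 hab), zero_mul]

theorem charIsometry_isHilbertSum [CompleteSpace H] :
    IsHilbertSum ℂ (fun _ : Γ => H) (charIsometry Γ H) := by
  refine IsHilbertSum.mk (charIsometry_orthogonal Γ H) ?_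
  rw [top_le_iff, Submodule.topologicalClosure_eq_top_iff, Submodule.eq_bot_iff]
  intro g hg
  rw [Lp.eq_zero_iff_ae_eq_zero]
  refine ae_eq_zero_of_forall_inner (𝕜 := ℂ) fun x => ?_
  set h : Lp ℂ 2 (dualHaar Γ) := (innerSL ℂ x).compLp g with hh
  have hcoe := ContinuousLinearMap.coeFn_compLp (innerSL ℂ x) g
  rw [← hh] at hcoe
  suffices h0 : h = 0 by
    filter_upwards [hcoe, (Lp.eq_zero_iff_ae_eq_zero).1 h0] with χ h1 h2
    rw [h1] at h2
    simpa using h2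
  have hspan := (ContinuousMap.toLp_denseRange ℂ (dualHaar Γ) ℂ
    (p := 2) (by simp)).topologicalClosure_map_submodule (span_char_dense (Γ := Γ))
  rw [Submodule.topologicalClosure_eq_top_iff, Submodule.eq_bot_iff] at hspan
  refine hspan h ?_
  rw [Submodule.map_span, Submodule.mem_orthogonal]
  intro u hu
  induction hu using Submodule.span_induction with
  | zero => simp
  | add u v _ _ hu hv => rw [inner_add_left, hu, hv, add_zero]
  | smul c u _ hu => rw [inner_smul_left, hu, mul_zero]
  | mem u hu =>
    obtain ⟨_, ⟨γ, rfl⟩, rfl⟩ := hu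
    have h1 : inner ℂ (charIsometry Γ H γ x) g = 0 :=
      (Submodule.mem_orthogonal _ _).1 hg _ (Submodule.mem_iSup_of_mem γ ⟨x, rfl⟩)
    rw [← h1, L2.inner_def, L2.inner_def]
    refine integral_congr_ae ?_
    filter_upwards [hcoe, coeFn_charFun_toLp γ x,
      ContinuousMap.coeFn_toLp (p := 2) (𝕜 := ℂ) (dualHaar Γ)
        (⟨fun χ => conj (ev χ γ), (continuous_ev γ).star⟩ : C(Dual Γ, ℂ))] with χ h2 h3 h4
    rw [h2]
    erw [h3, h4]
    simp [inner_smul_left, mul_comm]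

/-- The Fourier transform `F_H : ℓ²(Γ, H) → L²(Γ̂, H)`, the unitary operator with
`(F_H f)(χ) = ∑_γ conj (χ(γ)) f(γ)`, where the sum converges in `L²(Γ̂, H)`. -/
def fourierL2 [CompleteSpace H] : ell2 Γ H ≃ₗᵢ[ℂ] L2Dual Γ H :=
  (charIsometry_isHilbertSum Γ H).linearIsometryEquiv.symm

theorem hasSum_fourierL2 [CompleteSpace H] (f : ell2 Γ H) :
    HasSum (fun γ => charIsometry Γ H γ (f γ)) (fourierL2 Γ H f) :=
  (charIsometry_isHilbertSum Γ H).hasSum_linearIsometryEquiv_symm f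

end Fourier

section Reindexing

variable {Γ V ι X : Type*} [Fintype ι] [NormedAddCommGroup X] [InnerProductSpace ℂ X]

/-- The Hilbert space `X^ι`, the direct sum of copies of `X` indexed by a finite set `ι`. -/
abbrev Pow (X ι : Type*) : Type _ := PiLp 2 (fun _ : ι => X)

instance [FiniteDimensional ℂ X] : CompleteSpace (Pow X ι) := FiniteDimensional.complete ℂ _

instance [FiniteDimensional ℂ X] : SecondCountableTopology (Pow X ι) :=
  haveI : ProperSpace (Pow X ι) := FiniteDimensional.proper ℂ _
  inferInstance

theorem ell2_summable {J H : Type*} [NormedAddCommGroup H] (f : ell2 J H) :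
    Summable fun j => ‖f j‖ ^ 2 := by
  simpa using (lp.memℓp f).summable (by norm_num)

theorem memell2 {J H : Type*} [NormedAddCommGroup H] {f : J → H}
    (hf : Summable fun j => ‖f j‖ ^ 2) : Memℓp f 2 := memℓp_gen (by simpa using hf)

theorem ell2_norm_sq {J H : Type*} [NormedAddCommGroup H] (f : ell2 J H) :
    ‖f‖ ^ 2 = ∑' j, ‖f j‖ ^ 2 := by
  simpa using lp.norm_rpow_eq_tsum (p := 2) (by norm_num) f

theorem summable_reindex (b : Γ × ι ≃ V) (z : ell2 V X) :
    Summable fun p : Γ × ι => ‖z (b p)‖ ^ 2 :=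
  b.summable_iff.2 (ell2_summable z)

theorem summable_uncurry (f : ell2 Γ (Pow X ι)) :
    Summable fun p : Γ × ι => ‖f p.1 p.2‖ ^ 2 := by
  refine (summable_prod_of_nonneg (fun _ => sq_nonneg _)).2
    ⟨fun _ => (hasSum_fintype _).summable, ?_⟩
  simpa [PiLp.norm_sq_eq_of_L2, tsum_fintype] using ell2_summable f

/-- The map `ℓ²(V, X) → ℓ²(Γ, X^ι)`, `z ↦ ((z_{b(γ,i)})_{i ∈ ι})_{γ ∈ Γ}`, given by a bijection
`b : Γ × ι → V`. -/
def reindexFun (b : Γ × ι ≃ V) (z : ell2 V X) : ell2 Γ (Pow X ι) :=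
  ⟨fun γ => WithLp.toLp 2 fun i => z (b (γ, i)), memell2 (by
    simpa [PiLp.norm_sq_eq_of_L2, tsum_fintype] using
      ((summable_prod_of_nonneg (fun _ => sq_nonneg _)).1 (summable_reindex b z)).2)⟩

/-- The inverse of `reindexFun b`. -/
def reindexInv (b : Γ × ι ≃ V) (f : ell2 Γ (Pow X ι)) : ell2 V X :=
  ⟨fun v => f (b.symm v).1 (b.symm v).2, memell2 (b.symm.summable_iff.2 (summable_uncurry f))⟩

theorem norm_reindexFun (b : Γ × ι ≃ V) (z : ell2 V X) : ‖reindexFun b z‖ = ‖z‖ := by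
  have h1 : ∑' p : Γ × ι, ‖z (b p)‖ ^ 2 = ∑' v, ‖z v‖ ^ 2 := b.tsum_eq (fun v => ‖z v‖ ^ 2)
  have h2 : ∀ γ, ‖reindexFun b z γ‖ ^ 2 = ∑ i, ‖z (b (γ, i))‖ ^ 2 :=
    fun γ => PiLp.norm_sq_eq_of_L2 _ _
  rw [← sq_eq_sq₀ (norm_nonneg _) (norm_nonneg _), ell2_norm_sq, ell2_norm_sq, ← h1,
    (summable_reindex b z).tsum_prod]
  exact tsum_congr fun γ => by rw [h2, tsum_fintype]

/-- The isometric isomorphism `ℓ²(V, X) → ℓ²(Γ, X^ι)`, `z ↦ ((z_{b(γ,i)})_{i ∈ ι})_{γ ∈ Γ}`,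
given by a bijection `b : Γ × ι → V`. -/
def reindex (b : Γ × ι ≃ V) : ell2 V X ≃ₗᵢ[ℂ] ell2 Γ (Pow X ι) where
  toFun := reindexFun b
  map_add' _ _ := rfl
  map_smul' _ _ := rfl
  invFun := reindexInv b
  left_inv z := by
    ext v
    change z (b ((b.symm v).1, (b.symm v).2)) = z v
    rw [Prod.mk.eta, b.apply_symm_apply]
  right_inv f := by
    ext γ i
    change f (b.symm (b (γ, i))).1 (b.symm (b (γ, i))).2 = f γ i
    rw [b.symm_apply_apply]
  norm_map' := norm_reindexFun b

/-- The isometric isomorphism of `ℓ²(Γ, H)` that applies the unitary `U γ` at each `γ`. -/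
def diagonal {H : Type*} [NormedAddCommGroup H] [InnerProductSpace ℂ H]
    (U : Γ → H ≃ₗᵢ[ℂ] H) : ell2 Γ H ≃ₗᵢ[ℂ] ell2 Γ H where
  toFun f := ⟨fun γ => U γ (f γ), memell2 (by simpa using ell2_summable f)⟩
  map_add' f g := by ext γ; exact (U γ).map_add _ _
  map_smul' c f := by ext γ; exact (U γ).map_smul _ _
  invFun f := ⟨fun γ => (U γ).symm (f γ), memell2 (by simpa using ell2_summable f)⟩
  left_inv f := by ext γ; exact (U γ).symm_apply_apply _
  right_inv f := by ext γ; exact (U γ).apply_symm_apply _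
  norm_map' f := by
    rw [← sq_eq_sq₀ (norm_nonneg _) (norm_nonneg _), ell2_norm_sq, ell2_norm_sq]
    exact tsum_congr fun γ => by
      change ‖U γ (f γ)‖ ^ 2 = _
      rw [LinearIsometryEquiv.norm_map]

end Reindexing

/-- The multiplication operator `M_Φ : L²(Γ̂, H) → L²(Γ̂, K)`, `(M_Φ f)(χ) = Φ(χ) f(χ)` for almost
every `χ`, given by `Φ ∈ L^∞(Γ̂, B(H, K))`. -/
def mulOp {Γ : Type*} [AddCommGroup Γ] [TopologicalSpace Γ] [DiscreteTopology Γ]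
    {H K : Type*} [NormedAddCommGroup H] [InnerProductSpace ℂ H]
    [NormedAddCommGroup K] [InnerProductSpace ℂ K]
    (Φ : Lp (H →L[ℂ] K) ∞ (dualHaar Γ)) : L2Dual Γ H →L[ℂ] L2Dual Γ K :=
  (ContinuousLinearMap.id ℂ (H →L[ℂ] K)).holderL (dualHaar Γ) ∞ 2 2 Φ

theorem coeFn_mulOp {Γ : Type*} [AddCommGroup Γ] [TopologicalSpace Γ] [DiscreteTopology Γ]
    {H K : Type*} [NormedAddCommGroup H] [InnerProductSpace ℂ H]
    [NormedAddCommGroup K] [InnerProductSpace ℂ K]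
    (Φ : Lp (H →L[ℂ] K) ∞ (dualHaar Γ)) (f : L2Dual Γ H) :
    ∀ᵐ χ ∂(dualHaar Γ), mulOp Φ f χ = Φ χ (f χ) :=
  (ContinuousLinearMap.id ℂ (H →L[ℂ] K)).coeFn_holder Φ f

/-- A framework for `X` and `Y` on the simple graph `G`: linear maps `φ v w : X → Y` that vanish
off the edges of `G` and are antisymmetric on the edges. -/
structure Framework {V : Type*} (G : SimpleGraph V) (X Y : Type*)
    [NormedAddCommGroup X] [InnerProductSpace ℂ X]
    [NormedAddCommGroup Y] [InnerProductSpace ℂ Y] where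
  φ : V → V → X →ₗ[ℂ] Y
  φ_eq_zero : ∀ v w, ¬ G.Adj v w → φ v w = 0
  φ_antisymm : ∀ v w, G.Adj v w → φ v w = -φ w v

namespace Framework

variable {V : Type*} {G : SimpleGraph V} {X Y : Type*}
  [NormedAddCommGroup X] [InnerProductSpace ℂ X] [NormedAddCommGroup Y] [InnerProductSpace ℂ Y]

theorem φ_swap (F : Framework G X Y) (v w : V) : F.φ v w = -F.φ w v := by
  by_cases h : G.Adj v w
  · exact F.φ_antisymm v w h
  · rw [F.φ_eq_zero v w h, F.φ_eq_zero w v (fun h' => h h'.symm), neg_zero]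

/-- The coboundary matrix `C(G, φ)` as a map `X^V → Y^E`: the row of the edge `vw` has the entries
`φ v w` at `v` and `φ w v = -φ v w` at `w`, so it sends `z` to `φ v w (z v - z w)`, which does not
depend on the order of `v` and `w`. -/
def coboundary (F : Framework G X Y) (z : V → X) (e : G.edgeSet) : Y :=
  Sym2.lift ⟨fun v w => F.φ v w (z v - z w), fun v w => by
    change F.φ v w (z v - z w) = F.φ w v (z w - z v)
    rw [F.φ_swap v w, LinearMap.neg_apply, ← map_neg, neg_sub]⟩ e.1

end Framework

/-- A `Γ`-symmetric graph: an action `θ` of `Γ` on the simple graph `G` by automorphisms, free on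
the vertices and on the edges. -/
structure SymmetricGraph (Γ : Type*) [AddCommGroup Γ] {V : Type*} (G : SimpleGraph V) where
  θ : Multiplicative Γ →* (G ≃g G)
  free_vertices : ∀ γ : Γ, γ ≠ 0 → ∀ v : V, θ (Multiplicative.ofAdd γ) v ≠ v
  free_edges : ∀ γ : Γ, γ ≠ 0 → ∀ e : G.edgeSet, (θ (Multiplicative.ofAdd γ)).mapEdgeSet e ≠ e

namespace SymmetricGraph

variable {Γ : Type*} [AddCommGroup Γ] {V : Type*} {G : SimpleGraph V} (S : SymmetricGraph Γ G)

/-- The vertex `γv`. -/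
def act (γ : Γ) (v : V) : V := S.θ (Multiplicative.ofAdd γ) v

/-- The edge `γe`; for `e = vw` it is `(γv)(γw)`. -/
def actEdge (γ : Γ) (e : G.edgeSet) : G.edgeSet := (S.θ (Multiplicative.ofAdd γ)).mapEdgeSet e

theorem act_zero (v : V) : S.act 0 v = v := by simp [act]

theorem act_add (a b : Γ) (v : V) : S.act (a + b) v = S.act a (S.act b v) := by
  simp [act, ofAdd_add]

theorem actEdge_coe (γ : Γ) (e : G.edgeSet) : (S.actEdge γ e).1 = Sym2.map (S.act γ) e.1 := rfl

theorem actEdge_zero (e : G.edgeSet) : S.actEdge 0 e = e := by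
  apply Subtype.ext
  rw [actEdge_coe, show S.act 0 = id from funext S.act_zero, Sym2.map_id, id]

theorem actEdge_add (a b : Γ) (e : G.edgeSet) :
    S.actEdge (a + b) e = S.actEdge a (S.actEdge b e) := by
  apply Subtype.ext
  rw [actEdge_coe, actEdge_coe, actEdge_coe, Sym2.map_map]
  congr 1
  exact funext (S.act_add a b)

/-- Two vertices are equivalent if they lie in the same orbit. -/
def vertexSetoid : Setoid V where
  r v w := ∃ γ, S.act γ v = w
  iseqv :=
    { refl := fun v => ⟨0, S.act_zero v⟩
      symm := by
        rintro v _ ⟨γ, rfl⟩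
        exact ⟨-γ, by rw [← act_add, neg_add_cancel, act_zero]⟩
      trans := by
        rintro v _ _ ⟨a, rfl⟩ ⟨b, rfl⟩
        exact ⟨b + a, S.act_add b a v⟩ }

/-- Two edges are equivalent if they lie in the same orbit. -/
def edgeSetoid : Setoid G.edgeSet where
  r e f := ∃ γ, S.actEdge γ e = f
  iseqv :=
    { refl := fun e => ⟨0, S.actEdge_zero e⟩
      symm := by
        rintro e _ ⟨γ, rfl⟩
        exact ⟨-γ, by rw [← actEdge_add, neg_add_cancel, actEdge_zero]⟩
      trans := by
        rintro e _ _ ⟨a, rfl⟩ ⟨b, rfl⟩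
        exact ⟨b + a, S.actEdge_add b a e⟩ }

/-- The set `V₀` of vertex orbits. -/
abbrev VertexOrbit : Type _ := Quotient S.vertexSetoid

/-- The set `E₀` of edge orbits. -/
abbrev EdgeOrbit : Type _ := Quotient S.edgeSetoid

/-- A gain graph: a representative `rep a` of each vertex orbit `a`, and for each edge orbit `e` an
orientation `(src e, tgt e)` of it as an edge of the quotient graph, together with a gain, i.e. a
group element `γ` such that `ṽ(γw̃)` is an edge of `G` in the orbit `e`, where `ṽ`, `w̃` are the
representatives of `src e`, `tgt e`. -/
structure GainGraph where
  rep : S.VertexOrbit → V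
  rep_mem : ∀ a, Quotient.mk S.vertexSetoid (rep a) = a
  src : S.EdgeOrbit → S.VertexOrbit
  tgt : S.EdgeOrbit → S.VertexOrbit
  gain : S.EdgeOrbit → Γ
  adj : ∀ e, G.Adj (rep (src e)) (S.act (gain e) (rep (tgt e)))
  mem_orbit : ∀ e, Quotient.mk S.edgeSetoid
    ⟨s(rep (src e), S.act (gain e) (rep (tgt e))), adj e⟩ = e

namespace GainGraph

variable {S} (D : S.GainGraph)

/-- The representative edge `ẽ = ṽ(γw̃)` of an edge orbit. -/
def repEdge (e : S.EdgeOrbit) : G.edgeSet :=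
  ⟨s(D.rep (D.src e), S.act (D.gain e) (D.rep (D.tgt e))), D.adj e⟩

/-- The bijection `β_V : Γ × V₀ → V`, `(γ, [v]) ↦ γṽ`. -/
def vertexEquiv : Γ × S.VertexOrbit ≃ V :=
  Equiv.ofBijective (fun p => S.act p.1 (D.rep p.2)) (by
    constructor
    · rintro ⟨a, v⟩ ⟨b, w⟩ h
      change S.act a (D.rep v) = S.act b (D.rep w) at h
      have hvw : v = w := by
        rw [← D.rep_mem v, ← D.rep_mem w]
        refine Quotient.sound ⟨-b + a, ?_⟩
        rw [S.act_add, h, ← S.act_add, neg_add_cancel, S.act_zero]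
      subst hvw
      refine Prod.ext ?_ rfl
      by_contra hab
      refine S.free_vertices (-b + a) (fun h0 => hab ?_) (D.rep v) ?_
      · exact (neg_add_eq_zero.1 h0).symm
      · change S.act (-b + a) (D.rep v) = D.rep v
        rw [S.act_add, h, ← S.act_add, neg_add_cancel, S.act_zero]
    · intro v
      obtain ⟨γ, hγ⟩ := Quotient.exact (D.rep_mem (Quotient.mk S.vertexSetoid v))
      exact ⟨(γ, Quotient.mk S.vertexSetoid v), hγ⟩)

/-- The bijection `β_E : Γ × E₀ → E`, `(γ, [e]) ↦ γẽ`. -/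
def edgeEquiv : Γ × S.EdgeOrbit ≃ G.edgeSet :=
  Equiv.ofBijective (fun p => S.actEdge p.1 (D.repEdge p.2)) (by
    constructor
    · rintro ⟨a, e⟩ ⟨b, f⟩ h
      change S.actEdge a (D.repEdge e) = S.actEdge b (D.repEdge f) at h
      have hef : e = f := by
        rw [← D.mem_orbit e, ← D.mem_orbit f]
        refine Quotient.sound ⟨-b + a, ?_⟩
        change S.actEdge (-b + a) (D.repEdge e) = D.repEdge f
        rw [S.actEdge_add, h, ← S.actEdge_add, neg_add_cancel, S.actEdge_zero]
      subst hef
      refine Prod.ext ?_ rfl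
      by_contra hab
      refine S.free_edges (-b + a) (fun h0 => hab ?_) (D.repEdge e) ?_
      · exact (neg_add_eq_zero.1 h0).symm
      · change S.actEdge (-b + a) (D.repEdge e) = D.repEdge e
        rw [S.actEdge_add, h, ← S.actEdge_add, neg_add_cancel, S.actEdge_zero]
    · intro e
      obtain ⟨γ, hγ⟩ := Quotient.exact (D.mem_orbit (Quotient.mk S.edgeSetoid e))
      exact ⟨(γ, Quotient.mk S.edgeSetoid e), hγ⟩)

end GainGraph

end SymmetricGraph

/-- A `Γ`-symmetric framework `(G, φ, θ, τ)`: a framework `(G, φ)` and a `Γ`-symmetric graph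
`(G, θ)` together with a homomorphism `τ` from `Γ` to the group of affine isometries of `X` such
that `φ (γv) (γw) = φ v w ∘ dτ(-γ)`, where `dτ` denotes the linear part of `τ`. -/
structure SymmetricFramework (Γ : Type*) [AddCommGroup Γ] {V : Type*} (G : SimpleGraph V)
    (X Y : Type*) [NormedAddCommGroup X] [InnerProductSpace ℂ X]
    [NormedAddCommGroup Y] [InnerProductSpace ℂ Y]
    extends Framework G X Y, SymmetricGraph Γ G where
  τ : Multiplicative Γ →* (X ≃ᵃⁱ[ℂ] X)
  equivariant : ∀ (γ : Γ) (v w : V) (x : X),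
    φ (θ (Multiplicative.ofAdd γ) v) (θ (Multiplicative.ofAdd γ) w) x =
      φ v w ((τ (Multiplicative.ofAdd (-γ))).linearIsometryEquiv x)

/-- The condition on `φ` with the affine maps `τ(-γ)` in place of their linear parts implies the
one with the linear parts, because the maps `φ v w` are linear. -/
theorem equivariant_of_affine {X Y : Type*} [NormedAddCommGroup X] [InnerProductSpace ℂ X]
    [NormedAddCommGroup Y] [InnerProductSpace ℂ Y] (f g : X →ₗ[ℂ] Y) (t : X ≃ᵃⁱ[ℂ] X)
    (h : ∀ x, f x = g (t x)) (x : X) : f x = g (t.linearIsometryEquiv x) := by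
  have h0 : g (t 0) = 0 := by rw [← h 0, map_zero]
  have h1 := t.map_vadd 0 x
  simp only [vadd_eq_add, add_zero] at h1
  rw [h x, h1, map_add, h0, add_zero]

namespace SymmetricFramework

variable {Γ : Type*} [AddCommGroup Γ] {V : Type*} {G : SimpleGraph V}
  {X Y : Type*} [NormedAddCommGroup X] [InnerProductSpace ℂ X] [FiniteDimensional ℂ X]
  [NormedAddCommGroup Y] [InnerProductSpace ℂ Y] [FiniteDimensional ℂ Y]
  (F : SymmetricFramework Γ G X Y)

/-- The set `V₀` of vertex orbits. -/
abbrev V₀ : Type _ := F.toSymmetricGraph.VertexOrbit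

/-- The set `E₀` of edge orbits. -/
abbrev E₀ : Type _ := F.toSymmetricGraph.EdgeOrbit

variable [Fintype F.V₀] [Fintype F.E₀]

/-- The unitary `τ̃(γ)` of `X^{V₀}`, which applies the linear part of `τ(γ)` in each component. -/
def tauTilde (γ : Γ) : Pow X F.V₀ ≃ₗᵢ[ℂ] Pow X F.V₀ :=
  LinearIsometryEquiv.piLpCongrRight 2
    fun _ => (F.τ (Multiplicative.ofAdd γ)).linearIsometryEquiv

/-- The operator `T` on `ℓ²(Γ, X^{V₀})` with `(T f)(γ) = τ̃(-γ) f(γ)`. -/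
def twist : ell2 Γ (Pow X F.V₀) ≃ₗᵢ[ℂ] ell2 Γ (Pow X F.V₀) :=
  diagonal fun γ => F.tauTilde (-γ)

variable (D : F.toSymmetricGraph.GainGraph)

/-- `S_V : ℓ²(V, X) → ℓ²(Γ, X^{V₀})`, `S_V(z)_γ = (z_{γṽ})_{[v] ∈ V₀}`. -/
def shiftV : ell2 V X ≃ₗᵢ[ℂ] ell2 Γ (Pow X F.V₀) := reindex D.vertexEquiv

/-- `S_E : ℓ²(E, Y) → ℓ²(Γ, Y^{E₀})`, `S_E(z)_γ = (z_{γẽ})_{[e] ∈ E₀}`. -/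
def shiftE : ell2 G.edgeSet Y ≃ₗᵢ[ℂ] ell2 Γ (Pow Y F.E₀) := reindex D.edgeEquiv

open Classical in
/-- The entries of the `χ`-orbit matrix. The row of a non-loop `e = ([v], [w])` with gain `γ` has
the entries `φ ṽ (γw̃)` in the column `[v]` and `χ(γ) φ w̃ (-γṽ)` in the column `[w]`; the row of a
loop `e = ([v], [v])` with gain `γ` has the entry `φ ṽ (γṽ) + χ(γ) φ ṽ (-γṽ)` in the column `[v]`;
all other entries are zero. -/
def orbitEntry [TopologicalSpace Γ] (χ : Dual Γ) (e : F.E₀) (a : F.V₀) : X →ₗ[ℂ] Y :=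
  let v := D.rep (D.src e)
  let w := D.rep (D.tgt e)
  let γ := D.gain e
  if D.src e = D.tgt e then
    if a = D.src e then F.φ v (F.act γ v) + ev χ γ • F.φ v (F.act (-γ) v) else 0
  else if a = D.src e then F.φ v (F.act γ w)
  else if a = D.tgt e then ev χ γ • F.φ w (F.act (-γ) v)
  else 0

/-- The `χ`-orbit matrix `O(χ)` as an operator `X^{V₀} → Y^{E₀}`. -/
def orbitMatrix [TopologicalSpace Γ] (χ : Dual Γ) : Pow X F.V₀ →L[ℂ] Pow Y F.E₀ :=
  LinearMap.toContinuousLinearMap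
    { toFun := fun x => WithLp.toLp 2 fun e => ∑ a, F.orbitEntry D χ e a (x a)
      map_add' := fun x y => by ext e; simp [Finset.sum_add_distrib]
      map_smul' := fun c x => by ext e; simp [Finset.smul_sum] }

/-- `Φ ∈ L^∞(Γ̂, B(X^{V₀}, Y^{E₀}))` is a symbol function of the symmetric framework (with respect
to a gain graph): the coboundary matrix is a bounded operator `C : ℓ²(V, X) → ℓ²(E, Y)`, and
`C = S_E⁻¹ ∘ F⁻¹ ∘ M_Φ ∘ F ∘ T ∘ S_V`, with the Fourier transforms `F` of `ℓ²(Γ, X^{V₀})` and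
`ℓ²(Γ, Y^{E₀})`. -/
def IsSymbolFunction [TopologicalSpace Γ] [DiscreteTopology Γ]
    (Φ : Lp (Pow X F.V₀ →L[ℂ] Pow Y F.E₀) ∞ (dualHaar Γ)) : Prop :=
  ∃ C : ell2 V X →L[ℂ] ell2 G.edgeSet Y,
    (∀ (z : ell2 V X) (e : G.edgeSet), C z e = F.coboundary (fun v => z v) e) ∧
    ∀ z : ell2 V X, C z =
      (F.shiftE D).symm ((fourierL2 Γ (Pow Y F.E₀)).symm
        (mulOp Φ (fourierL2 Γ (Pow X F.V₀) (F.twist (F.shiftV D z)))))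

end SymmetricFramework

end

end SymFrame

namespace SymFrame

noncomputable section

/-! ### Trigonometric polynomials as multipliers on the dual group. -/

section TrigonometricSymbol

variable {Γ : Type*} [AddCommGroup Γ] [TopologicalSpace Γ] [DiscreteTopology Γ]
  {H K : Type*} [NormedAddCommGroup H] [InnerProductSpace ℂ H] [SecondCountableTopology H]
  [CompleteSpace H] [NormedAddCommGroup K] [InnerProductSpace ℂ K] [SecondCountableTopology K]
  [CompleteSpace K]

/-! In the coordinates of the gain graph the coboundary matrix is a finite convolution. At the edge
γẽ, where ẽ = ṽ(gw̃), equivariance moves γ from φ onto the vector, where it is absorbed by the twist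
f(γ) = dτ(-γ) z(γ·); antisymmetry turns the minus sign in z_v - z_w into the entry φ w̃ (-gṽ). The
value at γẽ becomes φ ṽ (gw̃) f(γ)_v + φ w̃ (-gṽ) f(γ + g)_w (`coboundary_edgeEquiv`).

With the convention (F f)(χ) = ∑ conj χ(γ) f(γ), translation f ↦ f(· + g) is multiplication by χ(g).
The convolution therefore has as its symbol a trigonometric polynomial A + ∑ χ(g_e) B_e
(`fourierL2_symm_mulOp_apply`), and this polynomial is the orbit matrix (`orbitMatrix_eq`). It is
continuous on a compact group, hence essentially bounded, which yields both the boundedness of the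
coboundary operator and the existence of a symbol.

For uniqueness, the unitaries around `mulOp Φ` cancel, and a multiplication operator determines its
symbol almost everywhere by its values on constant functions (`ae_eq_of_mulOp_eq`). -/

theorem fourierL2_single [DecidableEq Γ] (γ : Γ) (x : H) :
    fourierL2 Γ H (lp.single 2 γ x) = charIsometry Γ H γ x :=
  (charIsometry_isHilbertSum Γ H).linearIsometryEquiv_symm_apply_single x

omit [CompleteSpace H] [CompleteSpace K] in
/-- A trigonometric polynomial symbol sends the conjugate character of `δ` to a sum of shifts of it. -/
theorem mulOp_charIsometry {ι : Type*} [Fintype ι] {A : H →L[ℂ] K} {B : ι → H →L[ℂ] K}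
    {g : ι → Γ} {Φ : Lp (H →L[ℂ] K) ∞ (dualHaar Γ)}
    (hΦ : ∀ᵐ χ ∂(dualHaar Γ), Φ χ = A + ∑ i, ev χ (g i) • B i) (δ : Γ) (x : H) :
    mulOp Φ (charIsometry Γ H δ x) =
      charIsometry Γ K δ (A x) + ∑ i, charIsometry Γ K (δ - g i) (B i x) := by
  have hsum : ∀ᵐ χ ∂(dualHaar Γ), ∀ i,
      charIsometry Γ K (δ - g i) (B i x) χ = conj (ev χ (δ - g i)) • B i x :=
    ae_all_iff.2 fun i => coeFn_charFun_toLp (δ - g i) (B i x)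
  refine Lp.ext ?_
  filter_upwards [coeFn_mulOp Φ (charIsometry Γ H δ x), hΦ, coeFn_charFun_toLp δ x,
    coeFn_charFun_toLp δ (A x), hsum,
    Lp.coeFn_add (charIsometry Γ K δ (A x)) (∑ i, charIsometry Γ K (δ - g i) (B i x)),
    Lp.coeFn_finsetSum Finset.univ fun i => charIsometry Γ K (δ - g i) (B i x)]
    with χ h1 h2 h3 h4 h5 h6 h7
  have h3' : charIsometry Γ H δ x χ = conj (ev χ δ) • x := h3
  have h4' : charIsometry Γ K δ (A x) χ = conj (ev χ δ) • A x := h4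
  rw [h1, h2, h3', h6, Pi.add_apply, h4', h7, Finset.sum_apply]
  simp only [h5, add_apply, sum_apply, smul_apply, map_smul,
    smul_add, Finset.smul_sum, smul_smul]
  congr 1
  refine Finset.sum_congr rfl fun i _ => ?_
  -- The shift is by -g i because conj χ(δ) · χ(g i) = conj χ(δ - g i).
  rw [sub_eq_add_neg, ev_add, ev_neg, map_mul, Complex.conj_conj]

/-- Multiplication by the trigonometric polynomial `A + ∑ i, χ(g i) B i` is on the Fourier side the
convolution operator `f ↦ (γ ↦ A f(γ) + ∑ i, B i f(γ + g i))`. -/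
theorem fourierL2_symm_mulOp_apply {ι : Type*} [Fintype ι] {A : H →L[ℂ] K}
    {B : ι → H →L[ℂ] K} {g : ι → Γ} {Φ : Lp (H →L[ℂ] K) ∞ (dualHaar Γ)}
    (hΦ : ∀ᵐ χ ∂(dualHaar Γ), Φ χ = A + ∑ i, ev χ (g i) • B i) (f : ell2 Γ H) (γ : Γ) :
    (fourierL2 Γ K).symm (mulOp Φ (fourierL2 Γ H f)) γ
      = A (f γ) + ∑ i, B i (f (γ + g i)) := by
  classical
  let L : ell2 Γ H →L[ℂ] K := (lp.evalCLM ℂ (fun _ : Γ => K) 2 γ).comp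
    (((fourierL2 Γ K).symm.toContinuousLinearEquiv : L2Dual Γ K →L[ℂ] ell2 Γ K).comp
      ((mulOp Φ).comp ((fourierL2 Γ H).toContinuousLinearEquiv : ell2 Γ H →L[ℂ] L2Dual Γ H)))
  let R : ell2 Γ H →L[ℂ] K := A.comp (lp.evalCLM ℂ (fun _ : Γ => H) 2 γ) +
    ∑ i, (B i).comp (lp.evalCLM ℂ (fun _ : Γ => H) 2 (γ + g i))
  have hLR : L = R := by
    -- Both sides are bounded in f and the exponent 2 is finite, so it suffices to compare them on
    -- functions supported at one point δ.
    refine lp.ext_continuousLinearMap (by simp) fun δ => ContinuousLinearMap.ext fun x => ?_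
    have h : (fourierL2 Γ K).symm (mulOp Φ (fourierL2 Γ H (lp.single 2 δ x))) =
        lp.single 2 δ (A x) + ∑ i, lp.single 2 (δ - g i) (B i x) := by
      rw [LinearIsometryEquiv.symm_apply_eq, fourierL2_single, mulOp_charIsometry hΦ, map_add,
        map_sum]
      simp only [fourierL2_single]
    change (fourierL2 Γ K).symm (mulOp Φ (fourierL2 Γ H (lp.single 2 δ x))) γ
      = R (lp.single 2 δ x)
    have hR : R (lp.single 2 δ x) = A ((lp.single 2 δ x : ell2 Γ H) γ) +
        ∑ i, B i ((lp.single 2 δ x : ell2 Γ H) (γ + g i)) := by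
      simp only [R, add_apply, sum_apply, ContinuousLinearMap.comp_apply]
      rfl
    rw [h, hR, lp.coeFn_add, Pi.add_apply, lp.coeFn_sum, Finset.sum_apply]
    -- A mass at δ - g i is seen at γ exactly when γ + g i = δ.
    simp only [lp.single_apply, Pi.single_apply, eq_sub_iff_add_eq, apply_ite A, apply_ite (B _),
      map_zero]
  have hR : R f = A (f γ) + ∑ i, B i (f (γ + g i)) := by
    simp only [R, add_apply, sum_apply, ContinuousLinearMap.comp_apply]
    rfl
  rw [← hR, ← hLR]
  rfl

omit [SecondCountableTopology K] [CompleteSpace K] [CompleteSpace H] in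
/-- An essentially bounded operator-valued function is determined by its multiplication operator. -/
theorem ae_eq_of_mulOp_eq [FiniteDimensional ℂ H] {Φ Ψ : Lp (H →L[ℂ] K) ∞ (dualHaar Γ)}
    (h : mulOp Φ = mulOp Ψ) : ∀ᵐ χ ∂(dualHaar Γ), Φ χ = Ψ χ := by
  let b := Module.finBasis ℂ H
  have hb : ∀ᵐ χ ∂(dualHaar Γ), ∀ i, Φ χ (b i) = Ψ χ (b i) := by
    refine ae_all_iff.2 fun i => ?_
    -- At index 0 the character factor is 1, so this test function is the constant b i. A finite
    -- basis leaves only finitely many null sets to discard.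
    have hΦ := coeFn_mulOp Φ (charIsometry Γ H 0 (b i))
    rw [h] at hΦ
    filter_upwards [hΦ, coeFn_mulOp Ψ (charIsometry Γ H 0 (b i)),
      coeFn_charFun_toLp (0 : Γ) (b i)] with χ h1 h2 h3
    have h3' : charIsometry Γ H 0 (b i) χ = b i := by
      refine h3.trans ?_
      rw [ev_zero, map_one, one_smul]
    rw [h3'] at h1 h2
    exact h1.symm.trans h2
  filter_upwards [hb] with χ hχ
  exact ContinuousLinearMap.coe_injective (b.ext hχ)

omit [SecondCountableTopology H] [CompleteSpace H] [SecondCountableTopology K] [CompleteSpace K] in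
-- Compactness of the dual group makes a continuous function bounded. Finite dimensionality makes
-- the space of operators second countable, which gives strong measurability even when the dual
-- group is not second countable.
theorem exists_Lp_ae_eq_of_continuous [FiniteDimensional ℂ H] [FiniteDimensional ℂ K]
    {f : Dual Γ → H →L[ℂ] K} (hf : Continuous f) :
    ∃ Φ : Lp (H →L[ℂ] K) ∞ (dualHaar Γ), ∀ᵐ χ ∂(dualHaar Γ), Φ χ = f χ := by
  have : ProperSpace (H →L[ℂ] K) := FiniteDimensional.proper ℂ (H →L[ℂ] K)
  exact ⟨ContinuousMap.toLp ∞ (dualHaar Γ) ℂ ⟨f, hf⟩, ContinuousMap.coeFn_toLp _ _⟩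

end TrigonometricSymbol

/-! ### Equivariance of the framework maps. -/

namespace SymmetricFramework

variable {Γ : Type*} [AddCommGroup Γ] {V : Type*} {G : SimpleGraph V}
  {X Y : Type*} [NormedAddCommGroup X] [InnerProductSpace ℂ X] [FiniteDimensional ℂ X]
  [NormedAddCommGroup Y] [InnerProductSpace ℂ Y] [FiniteDimensional ℂ Y]
  (F : SymmetricFramework Γ G X Y)

omit [FiniteDimensional ℂ X] [FiniteDimensional ℂ Y] in
theorem φ_act (γ : Γ) (v w : V) (x : X) :
    F.φ (F.act γ v) (F.act γ w) x =
      F.φ v w ((F.τ (Multiplicative.ofAdd (-γ))).linearIsometryEquiv x) :=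
  F.equivariant γ v w x

omit [FiniteDimensional ℂ X] [FiniteDimensional ℂ Y] in
theorem linearIsometryEquiv_τ_add (a b : Γ) (x : X) :
    (F.τ (Multiplicative.ofAdd (a + b))).linearIsometryEquiv x =
      (F.τ (Multiplicative.ofAdd a)).linearIsometryEquiv
        ((F.τ (Multiplicative.ofAdd b)).linearIsometryEquiv x) := by
  rw [ofAdd_add, map_mul]
  rfl

omit [FiniteDimensional ℂ X] [FiniteDimensional ℂ Y] in
-- Translating the pair (v, γw) by -γ gives (-γv, w); antisymmetry then exchanges the two vertices.
-- This relates the target entry of an orbit-matrix row to its source entry.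
theorem φ_neg_act (γ : Γ) (v w : V) (x : X) :
    F.φ w (F.act (-γ) v) x =
      -F.φ v (F.act γ w) ((F.τ (Multiplicative.ofAdd γ)).linearIsometryEquiv x) := by
  have h := F.φ_act (-γ) v (F.act γ w) x
  rw [← F.act_add, neg_add_cancel, F.act_zero, neg_neg] at h
  rw [F.φ_swap, LinearMap.neg_apply, h]

/-! ### The orbit matrix as a trigonometric polynomial. -/

variable [Fintype F.V₀] [Fintype F.E₀] (D : F.toSymmetricGraph.GainGraph)

/-- The part of the orbit matrix that does not depend on the character: the row of an edge orbit
has the entry `φ ṽ (γw̃)` at its source. -/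
def sourceMatrix : Pow X F.V₀ →L[ℂ] Pow Y F.E₀ :=
  LinearMap.toContinuousLinearMap
    { toFun := fun x => WithLp.toLp 2 fun e =>
        F.φ (D.rep (D.src e)) (F.act (D.gain e) (D.rep (D.tgt e))) (x (D.src e))
      map_add' := fun x y => by ext e; simp
      map_smul' := fun c x => by ext e; simp }

open Classical in
/-- The matrix whose only nonzero row is the row of `e`, with the entry `φ w̃ (-γṽ)` at the target
of `e`. -/
def targetMatrix (e : F.E₀) : Pow X F.V₀ →L[ℂ] Pow Y F.E₀ :=
  LinearMap.toContinuousLinearMap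
    { toFun := fun x => WithLp.toLp 2 fun e' => if e' = e then
        F.φ (D.rep (D.tgt e)) (F.act (-D.gain e) (D.rep (D.src e))) (x (D.tgt e)) else 0
      map_add' := fun x y => by ext e'; by_cases h : e' = e <;> simp [h]
      map_smul' := fun c x => by ext e'; by_cases h : e' = e <;> simp [h] }

omit [FiniteDimensional ℂ Y] in
theorem sourceMatrix_apply (x : Pow X F.V₀) (e : F.E₀) : F.sourceMatrix D x e =
    F.φ (D.rep (D.src e)) (F.act (D.gain e) (D.rep (D.tgt e))) (x (D.src e)) := rfl

omit [FiniteDimensional ℂ Y] in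
open Classical in
theorem targetMatrix_apply (e e' : F.E₀) (x : Pow X F.V₀) : F.targetMatrix D e x e' =
    if e' = e then
      F.φ (D.rep (D.tgt e)) (F.act (-D.gain e) (D.rep (D.src e))) (x (D.tgt e)) else 0 := rfl

omit [FiniteDimensional ℂ X] [FiniteDimensional ℂ Y] [Fintype F.E₀] in
-- Loops need no separate formula: when source and target coincide, the two contributions fall in
-- the same column and add up to the loop entry.
theorem sum_orbitEntry [TopologicalSpace Γ] (χ : Dual Γ) (e : F.E₀) (x : Pow X F.V₀) :
    ∑ a, F.orbitEntry D χ e a (x a) =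
      F.φ (D.rep (D.src e)) (F.act (D.gain e) (D.rep (D.tgt e))) (x (D.src e)) +
      ev χ (D.gain e) •
        F.φ (D.rep (D.tgt e)) (F.act (-D.gain e) (D.rep (D.src e))) (x (D.tgt e)) := by
  classical
  by_cases h : D.src e = D.tgt e
  · rw [Finset.sum_eq_single (D.src e)]
    · simp [orbitEntry, h]
    · intro a _ ha
      rw [orbitEntry, if_pos h, if_neg ha, LinearMap.zero_apply]
    · simp
  · rw [← Finset.add_sum_erase _ _ (Finset.mem_univ (D.src e)),
      Finset.sum_eq_single (D.tgt e)]
    · simp [orbitEntry, h, Ne.symm h]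
    · intro a ha hat
      rw [orbitEntry, if_neg h, if_neg (Finset.ne_of_mem_erase ha), if_neg hat,
        LinearMap.zero_apply]
    · intro hmem
      exact absurd (Finset.mem_erase.2 ⟨Ne.symm h, Finset.mem_univ _⟩) hmem

omit [FiniteDimensional ℂ Y] in
/-- The orbit matrix is a trigonometric polynomial. -/
theorem orbitMatrix_eq [TopologicalSpace Γ] (χ : Dual Γ) :
    F.orbitMatrix D χ = F.sourceMatrix D + ∑ e, ev χ (D.gain e) • F.targetMatrix D e := by
  classical
  ext x e
  refine (F.sum_orbitEntry D χ e x).trans ?_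
  simp [sourceMatrix_apply, targetMatrix_apply]

/-! ### The coboundary matrix as a convolution. -/

omit [FiniteDimensional ℂ X] [FiniteDimensional ℂ Y] [Fintype F.E₀] in
theorem twist_shiftV_apply (z : ell2 V X) (γ : Γ) (a : F.V₀) :
    F.twist (F.shiftV D z) γ a =
      (F.τ (Multiplicative.ofAdd (-γ))).linearIsometryEquiv (z (F.act γ (D.rep a))) := rfl

omit [FiniteDimensional ℂ X] [FiniteDimensional ℂ Y] [Fintype F.E₀] in
/-- The coboundary matrix in the coordinates given by the gain graph. -/
theorem coboundary_edgeEquiv (z : ell2 V X) (γ : Γ) (e : F.E₀) :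
    F.coboundary (fun v => z v) (D.edgeEquiv (γ, e)) =
      F.φ (D.rep (D.src e)) (F.act (D.gain e) (D.rep (D.tgt e)))
        (F.twist (F.shiftV D z) γ (D.src e)) +
      F.φ (D.rep (D.tgt e)) (F.act (-D.gain e) (D.rep (D.src e)))
        (F.twist (F.shiftV D z) (γ + D.gain e) (D.tgt e)) := by
  have h : F.coboundary (fun v => z v) (D.edgeEquiv (γ, e)) =
      F.φ (F.act γ (D.rep (D.src e))) (F.act γ (F.act (D.gain e) (D.rep (D.tgt e))))
        (z (F.act γ (D.rep (D.src e))) - z (F.act γ (F.act (D.gain e) (D.rep (D.tgt e))))) := rfl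
  -- With g the gain, the twist at γ + g and the factor dτ(g) from `φ_neg_act` combine to dτ(g - (γ
  -- + g)) = dτ(-γ), the isometry that `φ_act` applies to both endpoints.
  rw [h, φ_act, φ_neg_act, twist_shiftV_apply, twist_shiftV_apply,
    ← linearIsometryEquiv_τ_add, map_sub, map_sub, ← F.act_add, sub_eq_add_neg]
  congr 5
  abel_nf

/-! ### Operators with a given symbol. -/

variable [TopologicalSpace Γ] [DiscreteTopology Γ]

/-- The composition `S_E⁻¹ ∘ F⁻¹ ∘ M_Φ ∘ F ∘ T ∘ S_V`. -/
def symbolOperator (Φ : Lp (Pow X F.V₀ →L[ℂ] Pow Y F.E₀) ∞ (dualHaar Γ)) :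
    ell2 V X →L[ℂ] ell2 G.edgeSet Y :=
  ((F.shiftE D).symm.toContinuousLinearEquiv : ell2 Γ (Pow Y F.E₀) →L[ℂ] ell2 G.edgeSet Y).comp
    (((fourierL2 Γ (Pow Y F.E₀)).symm.toContinuousLinearEquiv :
        L2Dual Γ (Pow Y F.E₀) →L[ℂ] ell2 Γ (Pow Y F.E₀)).comp
      ((mulOp Φ).comp
        (((fourierL2 Γ (Pow X F.V₀)).toContinuousLinearEquiv :
            ell2 Γ (Pow X F.V₀) →L[ℂ] L2Dual Γ (Pow X F.V₀)).comp
          (((F.shiftV D).trans F.twist).toContinuousLinearEquiv :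
            ell2 V X →L[ℂ] ell2 Γ (Pow X F.V₀)))))

theorem symbolOperator_apply (Φ : Lp (Pow X F.V₀ →L[ℂ] Pow Y F.E₀) ∞ (dualHaar Γ))
    (z : ell2 V X) : F.symbolOperator D Φ z =
      (F.shiftE D).symm ((fourierL2 Γ (Pow Y F.E₀)).symm
        (mulOp Φ (fourierL2 Γ (Pow X F.V₀) (F.twist (F.shiftV D z))))) := rfl

/-- Every factor around `mulOp Φ` is an isometric isomorphism, so it can be cancelled: evaluate at
the preimage of an arbitrary u, then strip the outer injective maps. -/
theorem symbolOperator_injective {Φ Ψ : Lp (Pow X F.V₀ →L[ℂ] Pow Y F.E₀) ∞ (dualHaar Γ)}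
    (h : F.symbolOperator D Φ = F.symbolOperator D Ψ) : mulOp Φ = mulOp Ψ := by
  ext1 u
  have hz := congrArg (fun L => L ((F.shiftV D).symm (F.twist.symm
    ((fourierL2 Γ (Pow X F.V₀)).symm u)))) h
  simp only [symbolOperator_apply, LinearIsometryEquiv.apply_symm_apply] at hz
  exact (fourierL2 Γ (Pow Y F.E₀)).symm.injective ((F.shiftE D).symm.injective hz)

/-- If `Φ` is almost everywhere the orbit matrix, then the operator with symbol `Φ` is the
coboundary matrix. -/
theorem symbolOperator_eq_coboundary {Φ : Lp (Pow X F.V₀ →L[ℂ] Pow Y F.E₀) ∞ (dualHaar Γ)}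
    (hΦ : ∀ᵐ χ ∂(dualHaar Γ), Φ χ = F.orbitMatrix D χ) (z : ell2 V X) (e : G.edgeSet) :
    F.symbolOperator D Φ z e = F.coboundary (fun v => z v) e := by
  classical
  -- Every edge is a translate γẽ, so the comparison can be made in coordinate e at γ, after
  -- applying S_E.
  obtain ⟨⟨γ, e⟩, rfl⟩ := D.edgeEquiv.surjective e
  have h1 : F.shiftE D (F.symbolOperator D Φ z) γ e =
      F.symbolOperator D Φ z (D.edgeEquiv (γ, e)) := rfl
  rw [coboundary_edgeEquiv, ← h1, symbolOperator_apply, LinearIsometryEquiv.apply_symm_apply,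
    fourierL2_symm_mulOp_apply (hΦ.mono fun χ h => h.trans (F.orbitMatrix_eq D χ))]
  simp [sourceMatrix_apply, targetMatrix_apply]

/-- The orbit matrix as an element of `L^∞`. -/
theorem exists_ae_eq_orbitMatrix :
    ∃ Φ : Lp (Pow X F.V₀ →L[ℂ] Pow Y F.E₀) ∞ (dualHaar Γ),
      ∀ᵐ χ ∂(dualHaar Γ), Φ χ = F.orbitMatrix D χ := by
  have hc : Continuous fun χ : Dual Γ => F.orbitMatrix D χ := by
    simp only [orbitMatrix_eq]
    exact continuous_const.add
      (continuous_finsetSum _ fun e _ => (continuous_ev _).smul continuous_const)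
  exact exists_Lp_ae_eq_of_continuous hc

end SymmetricFramework

end

end SymFrame

/-! ### Existence and uniqueness of the symbol. -/

theorem theorem3p7
    {Γ : Type*} [AddCommGroup Γ] [TopologicalSpace Γ] [DiscreteTopology Γ]
    {V : Type*} [Countable V] {G : SimpleGraph V}
    {X Y : Type*}
    [NormedAddCommGroup X] [InnerProductSpace ℂ X] [FiniteDimensional ℂ X]
    [NormedAddCommGroup Y] [InnerProductSpace ℂ Y] [FiniteDimensional ℂ Y]
    (F : SymFrame.SymmetricFramework Γ G X Y)
    [Fintype F.V₀] [Fintype F.E₀]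
    (D : F.toSymmetricGraph.GainGraph) :
    (∃ Φ : Lp (SymFrame.Pow X F.V₀ →L[ℂ] SymFrame.Pow Y F.E₀) ∞ (SymFrame.dualHaar Γ),
      F.IsSymbolFunction D Φ) ∧
    ∀ Φ : Lp (SymFrame.Pow X F.V₀ →L[ℂ] SymFrame.Pow Y F.E₀) ∞ (SymFrame.dualHaar Γ),
      F.IsSymbolFunction D Φ →
        ∀ᵐ χ ∂(SymFrame.dualHaar Γ), Φ χ = F.orbitMatrix D χ := by
  obtain ⟨Ψ, hΨ⟩ := F.exists_ae_eq_orbitMatrix D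
  have hΨC := F.symbolOperator_eq_coboundary D hΨ
  refine ⟨⟨Ψ, F.symbolOperator D Ψ, hΨC, F.symbolOperator_apply D Ψ⟩, ?_⟩
  rintro Φ ⟨C, hC, hCΦ⟩
  -- Both operators have the coboundary values in every coordinate: one by the assumption on Φ, the
  -- other by the choice of Ψ.
  have h : F.symbolOperator D Φ = F.symbolOperator D Ψ := by
    ext z e
    rw [F.symbolOperator_apply, ← hCΦ, hC, hΨC]
  filter_upwards [SymFrame.ae_eq_of_mulOp_eq (F.symbolOperator_injective D h), hΨ] with χ h1 h2
  exact h1.trans h2
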